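/- Notation. For a continuous function $f\colon[0,1]\to\mathbb R$ let $I(f)(x)=\int_0^x f(t)\,dt$, and let $I^2=I\circ I$, $I^3=I\circ I\circ I$. Give $C^\infty(\mathbb R)$ the topology generated by the seminorms $f\mapsto\sup_{x\in K}|D^jf(x)|$ ($j\ge 0$ an integer, $K\subseteq\mathbb R$ compact). On intervals with endpoints, derivatives at the endpoints are one-sided. Let $\delta\mapsto\sigma_\delta$ and $\delta\mapsto\tau_\delta$ be any continuous maps from $(0,\infty)$ into $C^\infty(\mathbb R)$ such that for every $\delta>0$: (i) $\sigma_\delta$ maps $[0,\delta]$ into $[0,\delta]$, $\sigma_\delta(0)=0$, $D\sigma_\delta>0$ on $(0,\delta]$, and $\sigma_\delta(x)=x$ for $\delta/2\le x\le\delta$; (ii) $\tau_\delta$ maps $[1-\delta,1]$ into $[1-\delta,1]$, $\tau_\delta(1)=1$, $D\tau_\delta>0$ on $[1-\delta,1)$, and $\tau_\delta(x)=x$ for $1-\delta\le x\le 1-\delta/2$. Theorem. Let $a,b,c$ be real numbers satisfying $$0<a<1,\qquad \frac{a^2}{2}<b<\frac a2,\qquad \frac{2b^2}{3a}<c<\frac{-a^2+2ab-4b^2+2b}{6(1-a)}.$$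 Then there is $\delta_0>0$ such that for every $\delta$ with $0<\delta<\delta_0$ there is a $C^\infty$ function $f\colon[0,1]\to[0,1]$ such that $f=\sigma_\delta$ on $[0,\delta/2]$, $f=\tau_\delta$ on $[1-\delta/2,1]$, $Df>0$ on $(0,1)$, $I(f)(1)=a$, $I^2(f)(1)=b$ and $I^3(f)(1)=c$. -/

import Mathlib

open Set Filter Topology
open scoped ContDiff

/-- Continuity, on the positive reals, of a map `δ ↦ φ δ` into `C^∞(ℝ)`, where `C^∞(ℝ)` carries the
topology generated by the seminorms `f ↦ sup {|D^j f(x)| : x ∈ K}`, with `j ≥ 0` an integer and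
`K ⊆ ℝ` compact: every derivative of `φ δ` converges to that of `φ δ₀`, uniformly on every compact
set, as `δ → δ₀`. -/
def ContinuousIntoSmooth (φ : ℝ → ℝ → ℝ) : Prop :=
  (∀ δ : ℝ, 0 < δ → ContDiff ℝ ∞ (φ δ)) ∧
    ∀ δ₀ : ℝ, 0 < δ₀ → ∀ (j : ℕ) (K : Set ℝ), IsCompact K →
      TendstoUniformlyOn (fun δ => iteratedDeriv j (φ δ)) (iteratedDeriv j (φ δ₀)) (𝓝 δ₀) K

/-- `σ` is an admissible family of germs at the left endpoint `0`: a continuous map `δ ↦ σ δ` from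
the positive reals into `C^∞(ℝ)` such that `σ δ` maps `[0, δ]` into itself, `σ δ 0 = 0`, the
derivative of `σ δ` is positive on `(0, δ]`, and `σ δ x = x` on `[δ/2, δ]`. -/
structure IsLeftEndFamily (σ : ℝ → ℝ → ℝ) : Prop where
  continuous : ContinuousIntoSmooth σ
  mapsTo : ∀ δ : ℝ, 0 < δ → MapsTo (σ δ) (Icc 0 δ) (Icc 0 δ)
  map_zero : ∀ δ : ℝ, 0 < δ → σ δ 0 = 0
  deriv_pos : ∀ δ : ℝ, 0 < δ → ∀ x ∈ Ioc 0 δ, 0 < deriv (σ δ) x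
  eq_self : ∀ δ : ℝ, 0 < δ → ∀ x ∈ Icc (δ / 2) δ, σ δ x = x

/-- `τ` is an admissible family of germs at the right endpoint `1`: a continuous map `δ ↦ τ δ` from
the positive reals into `C^∞(ℝ)` such that `τ δ` maps `[1 - δ, 1]` into itself, `τ δ 1 = 1`, the
derivative of `τ δ` is positive on `[1 - δ, 1)`, and `τ δ x = x` on `[1 - δ, 1 - δ/2]`. -/
structure IsRightEndFamily (τ : ℝ → ℝ → ℝ) : Prop where
  continuous : ContinuousIntoSmooth τ
  mapsTo : ∀ δ : ℝ, 0 < δ → MapsTo (τ δ) (Icc (1 - δ) 1) (Icc (1 - δ) 1)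
  map_one : ∀ δ : ℝ, 0 < δ → τ δ 1 = 1
  deriv_pos : ∀ δ : ℝ, 0 < δ → ∀ x ∈ Ico (1 - δ) 1, 0 < deriv (τ δ) x
  eq_self : ∀ δ : ℝ, 0 < δ → ∀ x ∈ Icc (1 - δ) (1 - δ / 2), τ δ x = x

/-- The integral operator `I(f)(x) = ∫₀ˣ f(t) dt`. -/
noncomputable def integralOp (f : ℝ → ℝ) : ℝ → ℝ :=
  fun x => ∫ t in (0 : ℝ)..x, f t

open MeasureTheory

/-! The three iterated integrals at `1` are integrals of `f` against `1`, `1 - x` and `(1 - x)^2 /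
2`, hence linear in `f`. The admissible `f` form a convex set, so the triples they attain form a
convex set `S` in `ℝ³`. The step function jumping at `1 - u` yields `(u, u^2/2, u^3/6)`, and the
hypotheses place `(a, b, c)` in an open set inside the convex hull of this curve
(`momentRegion_subset_convexHull`). Admissible functions come close to steps
(`exists_mem_increasingWithEnds_near_step`), so for small `δ` that hull, and with it a ball about
`(a, b, c)`, lies in a thickening of `S` thinner than the ball's radius. Convexity then forces `(a,
b, c)` into `S` itself, exactly and not just approximately (`Convex.mem_of_ball_subset_thickening`).
-/

/-! ### Convex sets and their thickenings -/

/-- Otherwise a functional `l` separates `q` from `closure S` with a gap. Moving from `q` by almost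
`ε` in a direction nearly norming `l` raises `l` by almost `ε * ‖l‖`, more than a point within `ε`
of `S` allows. -/
theorem Convex.subset_closure_of_add_ball {E : Type*} [NormedAddCommGroup E] [NormedSpace ℝ E]
    {S : Set E} (hS : Convex ℝ S) {q : E} {ε : ℝ} (hε : 0 < ε)
    (h : Metric.ball q ε ⊆ Metric.thickening ε S) : q ∈ closure S := by
  by_contra hq
  obtain ⟨l, u, hl, hu⟩ := geometric_hahn_banach_closed_point hS.closure isClosed_closure hq
  have hv : ∀ v ∈ Metric.ball (0 : E) 1, l (ε • v) ≤ ε * ‖l‖ - (l q - u) := by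
    intro v hv
    have hmem : q + ε • v ∈ Metric.ball q ε := by
      simp only [Metric.mem_ball, dist_self_add_left, norm_smul, Real.norm_eq_abs, abs_of_pos hε]
      have : ‖v‖ < 1 := by simpa using hv
      nlinarith
    obtain ⟨s, hs, hd⟩ := Metric.mem_thickening_iff.1 (h hmem)
    have h1 := hl s (subset_closure hs)
    have h2 : l (q + ε • v - s) ≤ ‖l‖ * ε :=
      (le_abs_self _).trans ((l.le_opNorm _).trans
        (mul_le_mul_of_nonneg_left (by rw [← dist_eq_norm]; exact hd.le) (norm_nonneg _)))
    simp only [map_sub, map_add] at h2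
    linarith
  have hn : ‖l‖ ≤ ‖l‖ - (l q - u) / ε := by
    refine le_of_forall_lt fun r hr => ?_
    by_contra hcon
    push Not at hcon
    obtain ⟨v, hv1, hv2⟩ := l.exists_lt_apply_of_lt_opNorm hr
    rw [Real.norm_eq_abs] at hv2
    have key : |l v| ≤ ‖l‖ - (l q - u) / ε := by
      have e : ε * (‖l‖ - (l q - u) / ε) = ε * ‖l‖ - (l q - u) := by field_simp
      refine abs_le.2 ⟨?_, ?_⟩ <;> refine le_of_mul_le_mul_left ?_ hε
      · have := hv (-v) (by simpa using hv1)
        simp only [map_smul, map_neg, smul_eq_mul] at this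
        linarith
      · have := hv v (by simpa using hv1)
        simp only [map_smul, smul_eq_mul] at this
        linarith
    linarith
  have : 0 < (l q - u) / ε := div_pos (by linarith) hε
  linarith

theorem Convex.mem_of_ball_subset_thickening {E : Type*} [NormedAddCommGroup E] [NormedSpace ℝ E]
    [FiniteDimensional ℝ E] {S : Set E} (hS : Convex ℝ S) {p : E} {r ε : ℝ} (hε : 0 < ε)
    (hr : ε < r) (h : Metric.ball p r ⊆ Metric.thickening ε S) : p ∈ S := by
  have hsub : Metric.ball p (r - ε) ⊆ closure S := fun q hq =>
    hS.subset_closure_of_add_ball hε ((Metric.ball_subset_ball' (by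
      rw [Metric.mem_ball] at hq; linarith)).trans h)
  have hp : p ∈ interior (closure S) :=
    interior_mono hsub (by
      rw [Metric.isOpen_ball.interior_eq]; exact Metric.mem_ball_self (by linarith))
  -- `S` and its closure share an interior once `S` has interior points. This follows from full
  -- affine span, inherited from `closure S` because affine subspaces are closed in finite
  -- dimension.
  have hspan : affineSpan ℝ S = ⊤ := by
    have hcl : closure S ⊆ (affineSpan ℝ S : Set E) :=
      closure_minimal (subset_affineSpan ℝ S) (AffineSubspace.closed_of_finiteDimensional _)
    have htop := hS.closure.interior_nonempty_iff_affineSpan_eq_top.1 ⟨p, hp⟩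
    exact top_le_iff.1 (htop ▸ affineSpan_le.2 hcl)
  rw [hS.interior_closure_eq_interior_of_nonempty_interior
    (hS.interior_nonempty_iff_affineSpan_eq_top.2 hspan)] at hp
  exact interior_subset hp

/-! ### The moment curve and its convex hull -/

/-- The iterated integrals at `1` of the step function jumping from `0` to `1` at `1 - u`. -/
noncomputable def momentCurve (u : ℝ) : ℝ × ℝ × ℝ := (u, u ^ 2 / 2, u ^ 3 / 6)

/-- The interior of the convex hull of the moment curve. -/
def momentRegion : Set (ℝ × ℝ × ℝ) :=
  {p | 0 < p.1 ∧ p.1 < 1 ∧ p.1 ^ 2 / 2 < p.2.1 ∧ p.2.1 < p.1 / 2 ∧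
    2 * p.2.1 ^ 2 < p.2.2 * (3 * p.1) ∧
    p.2.2 * (6 * (1 - p.1)) < -p.1 ^ 2 + 2 * p.1 * p.2.1 - 4 * p.2.1 ^ 2 + 2 * p.2.1}

theorem isOpen_momentRegion : IsOpen momentRegion := by
  unfold momentRegion
  refine (isOpen_lt ?_ ?_).and ((isOpen_lt ?_ ?_).and ((isOpen_lt ?_ ?_).and
    ((isOpen_lt ?_ ?_).and ((isOpen_lt ?_ ?_).and (isOpen_lt ?_ ?_))))) <;> fun_prop

/-- Seek a probability measure with atoms at `0`, `t`, `1` and moments `a`, `2b`, `6c`. Integrating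
`u(1-u)`, `u²(1-u)`, `u(1-u)²` gives `A`, `B`, `C` and sees only the atom at `t`, so `t = B/A` and
its weight is `A³/(BC)`. The other two weights are nonnegative when `A² ≤ (1-a)B` and `A² ≤ aC`,
which are the upper and lower bounds on `c`. -/
theorem momentRegion_subset_convexHull :
    momentRegion ⊆ convexHull ℝ (momentCurve '' Icc 0 1) := by
  rintro ⟨a, b, c⟩ ⟨h1, h2, h3, h4, h5, h6⟩
  dsimp only at h1 h2 h3 h4 h5 h6
  have hA : 0 < a - 2 * b := by linarith
  have hB : 0 < 2 * b - 6 * c := by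
    have : 0 < (1 - a) * (2 * b - 6 * c) := by nlinarith [sq_nonneg (a - 2 * b), mul_pos hA hA]
    exact pos_of_mul_pos_right this (by linarith)
  have hC : 0 < a - 4 * b + 6 * c := by
    have : 0 < a * (a - 4 * b + 6 * c) := by nlinarith [mul_pos hA hA]
    exact pos_of_mul_pos_right this h1.le
  set A := a - 2 * b with hAd
  set B := 2 * b - 6 * c with hBd
  set C := a - 4 * b + 6 * c with hCd
  have hABC : A = B + C := by rw [hAd, hBd, hCd]; ring
  have ht : B / A ∈ Icc (0 : ℝ) 1 := ⟨by positivity, by rw [div_le_one hA]; linarith⟩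
  have hw0 : 0 ≤ 1 - a - A ^ 2 / B := by
    rw [sub_nonneg, div_le_iff₀ hB, hAd, hBd]; nlinarith
  have hw1 : 0 ≤ a - A ^ 2 / C := by
    rw [sub_nonneg, div_le_iff₀ hC, hAd, hCd]; nlinarith
  have hmem : ∀ u ∈ Icc (0 : ℝ) 1, momentCurve u ∈ convexHull ℝ (momentCurve '' Icc 0 1) :=
    fun u hu => subset_convexHull ℝ _ (mem_image_of_mem _ hu)
  have key := (convex_convexHull ℝ (momentCurve '' Icc 0 1)).sum_mem (t := Finset.univ)
    (w := ![1 - a - A ^ 2 / B, A ^ 3 / (B * C), a - A ^ 2 / C])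
    (z := ![momentCurve 0, momentCurve (B / A), momentCurve 1])
    (by
      intro i _
      fin_cases i
      · exact hw0
      · exact div_nonneg (by positivity) (by positivity)
      · exact hw1)
    (by
      simp only [Fin.sum_univ_three, Matrix.cons_val]
      rw [hABC]; field_simp; ring)
    (by
      intro i _
      fin_cases i
      · exact hmem 0 (by simp)
      · exact hmem _ ht
      · exact hmem 1 (by simp))
  convert key using 1
  have hb : b = (a - A) / 2 := by rw [hAd]; ring
  have hc : c = (a - A - B) / 6 := by rw [hAd, hBd]; ring
  simp only [Fin.sum_univ_three, Matrix.cons_val, momentCurve, Prod.smul_mk, Prod.mk_add_mk,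
    smul_eq_mul, Prod.mk.injEq]
  refine ⟨?_, ?_, ?_⟩
  · field_simp; ring
  · rw [hb]; field_simp; rw [hABC]; ring
  · rw [hc]; field_simp; rw [hABC]; ring

/-! ### Iterated integrals as weighted integrals -/

/-- The triple of iterated integrals of `f` at `1`, as weighted integrals of `f`. -/
noncomputable def iteratedIntegrals (f : ℝ → ℝ) : ℝ × ℝ × ℝ :=
  (∫ x in (0 : ℝ)..1, 1 * f x, ∫ x in (0 : ℝ)..1, (1 - x) * f x,
    ∫ x in (0 : ℝ)..1, (1 - x) ^ 2 / 2 * f x)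

theorem hasDerivAt_integralOp {f : ℝ → ℝ} (hf : Continuous f) (x : ℝ) :
    HasDerivAt (integralOp f) (f x) x :=
  intervalIntegral.integral_hasDerivAt_right (hf.intervalIntegrable _ _)
    (hf.stronglyMeasurableAtFilter _ _) hf.continuousAt

theorem continuous_integralOp {f : ℝ → ℝ} (hf : Continuous f) : Continuous (integralOp f) :=
  continuous_iff_continuousAt.2 fun x => (hasDerivAt_integralOp hf x).continuousAt

/-- Integration by parts; the boundary terms vanish since `v 1 = 0` and `integralOp f 0 = 0`. -/
theorem integral_mul_integralOp {f v w : ℝ → ℝ} (hf : Continuous f) (hw : Continuous w)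
    (hv : ∀ x, HasDerivAt v (-w x) x) (hv1 : v 1 = 0) :
    ∫ x in (0 : ℝ)..1, w x * integralOp f x = ∫ x in (0 : ℝ)..1, v x * f x := by
  have h := intervalIntegral.integral_mul_deriv_eq_deriv_mul (a := 0) (b := 1)
    (fun x _ => hv x) (fun x _ => hasDerivAt_integralOp hf x)
    (hw.neg.intervalIntegrable _ _) (hf.intervalIntegrable _ _)
  have h0 : integralOp f 0 = 0 := intervalIntegral.integral_same
  simp only [hv1, h0, neg_mul, intervalIntegral.integral_neg] at h
  linarith

theorem iteratedIntegrals_eq {f : ℝ → ℝ} (hf : Continuous f) :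
    iteratedIntegrals f = (integralOp f 1, integralOp^[2] f 1, integralOp^[3] f 1) := by
  have hF := continuous_integralOp hf
  have d1 : ∀ x : ℝ, HasDerivAt (fun x : ℝ => 1 - x) (-1) x := fun x => by
    simpa using (hasDerivAt_id x).const_sub 1
  have d2 : ∀ x : ℝ, HasDerivAt (fun x : ℝ => (1 - x) ^ 2 / 2) (-(1 - x)) x := fun x =>
    (((d1 x).pow 2).div_const 2).congr_deriv (by norm_num; ring)
  have e2 : integralOp^[2] f 1 = ∫ x in (0 : ℝ)..1, (1 - x) * f x := by
    rw [← integral_mul_integralOp hf continuous_const d1 (by norm_num)]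
    simp [integralOp]
  have e3 : integralOp^[3] f 1 = ∫ x in (0 : ℝ)..1, (1 - x) ^ 2 / 2 * f x := by
    rw [← integral_mul_integralOp hf (by fun_prop) d2 (by norm_num),
      ← integral_mul_integralOp hF continuous_const d1 (by norm_num)]
    simp [integralOp]
  rw [e2, e3, iteratedIntegrals]
  simp [integralOp]

/-- The integrand error is at most `2 * δ` away from three intervals of length `δ` (both ends and
the jump), where one more unit suffices: `2δ + 3δ` in all. -/
theorem abs_integral_sub_integral_step_le {f w : ℝ → ℝ} {s δ : ℝ} (hf : Continuous f)
    (hw : Continuous w) (hδ : 0 ≤ δ) (hs0 : 0 ≤ s) (hs1 : s ≤ 1)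
    (hw1 : ∀ x ∈ Icc (0 : ℝ) 1, |w x| ≤ 1) (hf01 : MapsTo f (Icc 0 1) (Icc 0 1))
    (hlo : ∀ x ∈ Icc δ (1 - δ), x < s → f x ≤ 2 * δ)
    (hhi : ∀ x ∈ Icc δ (1 - δ), s + δ ≤ x → 1 - 2 * δ ≤ f x) :
    |(∫ x in (0 : ℝ)..1, w x * f x) - ∫ x in s..1, w x| ≤ 5 * δ := by
  have hstep : ∫ x in s..1, w x = ∫ x in (0 : ℝ)..1, w x * (Ioc s 1).indicator 1 x := by
    have e : (fun x => w x * (Ioc s 1).indicator (1 : ℝ → ℝ) x) = (Ioc s 1).indicator w := by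
      ext x; by_cases hx : x ∈ Ioc s 1 <;> simp [hx]
    rw [e, intervalIntegral.integral_of_le hs1, intervalIntegral.integral_of_le zero_le_one,
      setIntegral_indicator measurableSet_Ioc, inter_eq_right.2 (Ioc_subset_Ioc_left hs0)]
  have hone : ∀ p q : ℝ,
      IntervalIntegrable (fun x => (Icc p q).indicator (1 : ℝ → ℝ) x) volume 0 1 := fun p q =>
    (continuous_one.integrableOn_Icc.integrable_indicator measurableSet_Icc).intervalIntegrable
  have hstepi : IntervalIntegrable ((Ioc s 1).indicator (1 : ℝ → ℝ)) volume 0 1 :=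
    (continuous_one.integrableOn_Ioc.integrable_indicator measurableSet_Ioc).intervalIntegrable
  have hle : ∀ p : ℝ, ∫ x in (0 : ℝ)..1, (Icc p (p + δ)).indicator (1 : ℝ → ℝ) x ≤ δ := by
    intro p
    rw [intervalIntegral.integral_of_le zero_le_one, setIntegral_indicator measurableSet_Icc]
    simp only [Pi.one_apply, setIntegral_const, smul_eq_mul, mul_one]
    refine (measureReal_mono inter_subset_right (by simp)).trans ?_
    simp [hδ]
  have hwf : IntervalIntegrable (fun x => w x * f x) volume 0 1 :=
    (hw.mul hf).intervalIntegrable _ _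
  rw [hstep, ← intervalIntegral.integral_sub hwf (hstepi.continuousOn_mul hw.continuousOn)]
  have hbound : ∀ x ∈ Icc (0 : ℝ) 1, |w x * f x - w x * (Ioc s 1).indicator 1 x| ≤
      2 * δ + (Icc 0 (0 + δ)).indicator 1 x + (Icc (1 - δ) (1 - δ + δ)).indicator 1 x +
        (Icc s (s + δ)).indicator 1 x := by
    intro x hx
    obtain ⟨hf0, hf1⟩ := hf01 hx
    have hnn : ∀ p q : ℝ, 0 ≤ (Icc p q).indicator (1 : ℝ → ℝ) x := fun p q =>
      indicator_nonneg (fun _ _ => zero_le_one) x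
    have n1 := hnn 0 (0 + δ)
    have n2 := hnn (1 - δ) (1 - δ + δ)
    have n3 := hnn s (s + δ)
    rw [← mul_sub, abs_mul]
    refine (mul_le_of_le_one_left (abs_nonneg _) (hw1 x hx)).trans ?_
    have htriv : |f x - (Ioc s 1).indicator 1 x| ≤ 1 := by
      by_cases h : x ∈ Ioc s 1 <;> simp only [h, indicator_of_mem, indicator_of_notMem,
        not_false_eq_true, Pi.one_apply] <;> rw [abs_le] <;> constructor <;> linarith
    by_cases c1 : x ∈ Icc 0 (0 + δ)
    · rw [indicator_of_mem c1, Pi.one_apply]; linarith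
    by_cases c2 : x ∈ Icc (1 - δ) (1 - δ + δ)
    · rw [indicator_of_mem c2, Pi.one_apply]; linarith
    by_cases c3 : x ∈ Icc s (s + δ)
    · rw [indicator_of_mem c3, Pi.one_apply]; linarith
    have hxδ : x ∈ Icc δ (1 - δ) := by
      constructor
      · by_contra h; exact c1 ⟨hx.1, by linarith⟩
      · by_contra h; exact c2 ⟨by linarith, by linarith [hx.2]⟩
    suffices h : |f x - (Ioc s 1).indicator 1 x| ≤ 2 * δ by linarith
    rcases lt_or_ge x s with h | h
    · rw [indicator_of_notMem (fun h' => absurd h'.1 (not_lt.2 h.le)), sub_zero, abs_of_nonneg hf0]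
      exact hlo x hxδ h
    · have h' : s + δ < x := by by_contra h'; exact c3 ⟨h, by linarith⟩
      rw [indicator_of_mem (show x ∈ Ioc s 1 from ⟨by linarith, hx.2⟩), Pi.one_apply, abs_le]
      have := hhi x hxδ h'.le
      constructor <;> linarith
  have i1 : IntervalIntegrable (fun _ : ℝ => 2 * δ) volume 0 1 := intervalIntegrable_const
  have hi := ((i1.add (hone 0 (0 + δ))).add (hone (1 - δ) (1 - δ + δ))).add (hone s (s + δ))
  refine (intervalIntegral.abs_integral_le_integral_abs zero_le_one).trans ?_
  refine (intervalIntegral.integral_mono_on zero_le_one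
    (hwf.sub (hstepi.continuousOn_mul hw.continuousOn)).abs hi hbound).trans ?_
  rw [intervalIntegral.integral_add ((i1.add (hone _ _)).add (hone _ _)) (hone _ _),
    intervalIntegral.integral_add (i1.add (hone _ _)) (hone _ _),
    intervalIntegral.integral_add i1 (hone _ _), intervalIntegral.integral_const]
  have a1 := hle 0
  have a2 := hle (1 - δ)
  have a3 := hle s
  simp only [sub_zero, one_smul]
  linarith

/-! ### Increasing functions with prescribed end germs -/

/-- Smooth functions with end germs `σ` on `[0, δ/2]` and `τ` on `[1 - δ/2, 1]`, and with positive
derivative on `(0, 1)`. -/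
def increasingWithEnds (σ τ : ℝ → ℝ) (δ : ℝ) : Set (ℝ → ℝ) :=
  {f | ContDiff ℝ ∞ f ∧ EqOn f σ (Icc 0 (δ / 2)) ∧ EqOn f τ (Icc (1 - δ / 2) 1) ∧
    ∀ x ∈ Ioo (0 : ℝ) 1, 0 < deriv f x}

theorem convex_increasingWithEnds (σ τ : ℝ → ℝ) (δ : ℝ) :
    Convex ℝ (increasingWithEnds σ τ δ) := by
  rintro f ⟨hf, hfσ, hfτ, hf'⟩ g ⟨hg, hgσ, hgτ, hg'⟩ p q hp hq hpq
  refine ⟨(hf.const_smul p).add (hg.const_smul q), fun x hx => ?_, fun x hx => ?_, fun x hx => ?_⟩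
  · simp only [Pi.add_apply, Pi.smul_apply, smul_eq_mul, hfσ hx, hgσ hx]
    rw [← add_mul, hpq, one_mul]
  · simp only [Pi.add_apply, Pi.smul_apply, smul_eq_mul, hfτ hx, hgτ hx]
    rw [← add_mul, hpq, one_mul]
  · have df := (hf.differentiable (by simp) x).hasDerivAt
    have dg := (hg.differentiable (by simp) x).hasDerivAt
    rw [((df.const_smul p).add (dg.const_smul q)).deriv, smul_eq_mul, smul_eq_mul]
    have h1 := hf' x hx
    have h2 := hg' x hx
    rcases hp.eq_or_lt with rfl | hp
    · obtain rfl : q = 1 := by linarith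
      linarith
    · have := mul_pos hp h1
      have := mul_nonneg hq h2.le
      linarith

theorem mapsTo_of_mem_increasingWithEnds {σ τ f : ℝ → ℝ} {δ : ℝ} (hδ : 0 < δ) (h0 : σ 0 = 0)
    (h1 : τ 1 = 1) (hf : f ∈ increasingWithEnds σ τ δ) : MapsTo f (Icc 0 1) (Icc 0 1) := by
  obtain ⟨hf, hfσ, hfτ, hf'⟩ := hf
  have hmono : MonotoneOn f (Icc 0 1) :=
    (strictMonoOn_of_deriv_pos (convex_Icc 0 1) hf.continuous.continuousOn
      (by rwa [interior_Icc])).monotoneOn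
  have e0 : f 0 = 0 := (hfσ ⟨le_rfl, by linarith⟩).trans h0
  have e1 : f 1 = 1 := (hfτ ⟨by linarith, le_rfl⟩).trans h1
  intro x hx
  exact ⟨e0 ▸ hmono ⟨le_rfl, zero_le_one⟩ hx hx.1, e1 ▸ hmono hx ⟨zero_le_one, le_rfl⟩ hx.2⟩

/-- The derivative is `(1 - β) p' + β q' + β' (q - p)`; the last term is harmless when the cutoff
moves towards the larger function. -/
theorem deriv_blend_pos {p q β : ℝ → ℝ} {x : ℝ} (hp : Differentiable ℝ p)
    (hq : Differentiable ℝ q) (hβ : Differentiable ℝ β) (hβ0 : 0 ≤ β x) (hβ1 : β x ≤ 1)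
    (hp' : 0 < deriv p x) (hq' : 0 < deriv q x) (h : 0 ≤ deriv β x * (q x - p x)) :
    0 < deriv (fun y => q y + (1 - β y) * (p y - q y)) x := by
  have hd := (hq x).hasDerivAt.add (((hβ x).hasDerivAt.const_sub 1).mul
    ((hp x).hasDerivAt.sub (hq x).hasDerivAt))
  have e := hd.deriv
  simp only [Pi.sub_apply] at e
  refine lt_of_lt_of_eq ?_ e.symm
  have hpos : 0 < (1 - β x) * deriv p x + β x * deriv q x := by
    rcases hβ0.eq_or_lt with h0 | h0
    · rw [← h0]; linarith
    · have := mul_pos h0 hq'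
      have := mul_nonneg (sub_nonneg.2 hβ1) hp'.le
      linarith
  linarith

theorem deriv_smoothTransition_nonneg (x : ℝ) : 0 ≤ deriv Real.smoothTransition x :=
  Real.smoothTransition.monotone.deriv_nonneg

/-- A smooth increasing approximation, valued in `[δ, 1 - δ]` on `[0, 1]`, of the step function
jumping at `s`. -/
noncomputable def smoothStep (s δ x : ℝ) : ℝ :=
  δ + (1 - 2 * δ) * ((1 - δ) * Real.smoothTransition ((x - s) / δ) + δ * x)

theorem contDiff_smoothStep (s δ : ℝ) : ContDiff ℝ ∞ (smoothStep s δ) := by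
  have h : ContDiff ℝ ∞ fun x : ℝ => Real.smoothTransition ((x - s) / δ) :=
    Real.smoothTransition.contDiff.comp (by fun_prop)
  unfold smoothStep
  fun_prop

/-- The linear term `δ * x` keeps the slope positive where the transition is flat. -/
theorem deriv_smoothStep_pos {s δ : ℝ} (hδ : 0 < δ) (hδ' : δ < 1 / 2) (x : ℝ) :
    0 < deriv (smoothStep s δ) x := by
  have hT : HasDerivAt Real.smoothTransition (deriv Real.smoothTransition ((x - s) / δ))
      ((x - s) / δ) :=
    ((Real.smoothTransition.contDiff (n := 1)).differentiable (by simp) _).hasDerivAt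
  have hl : HasDerivAt (fun y : ℝ => (y - s) / δ) (1 / δ) x :=
    ((hasDerivAt_id x).sub_const s).div_const δ
  have hd : HasDerivAt (smoothStep s δ) ((1 - 2 * δ) * ((1 - δ) *
      (deriv Real.smoothTransition ((x - s) / δ) * (1 / δ)) + δ * 1)) x :=
    ((((hT.comp x hl).const_mul (1 - δ)).add ((hasDerivAt_id x).const_mul δ)).const_mul
      (1 - 2 * δ)).const_add δ
  rw [hd.deriv]
  have h1 := deriv_smoothTransition_nonneg ((x - s) / δ)
  have h2 : 0 ≤ (1 - δ) * (deriv Real.smoothTransition ((x - s) / δ) * (1 / δ)) :=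
    mul_nonneg (by linarith) (mul_nonneg h1 (by positivity))
  exact mul_pos (by linarith) (by linarith)

theorem smoothStep_mem_Icc {s δ x : ℝ} (hδ : 0 < δ) (hδ' : δ < 1 / 2) (hx : x ∈ Icc (0 : ℝ) 1) :
    smoothStep s δ x ∈ Icc δ (1 - δ) := by
  have t0 := Real.smoothTransition.nonneg ((x - s) / δ)
  have t1 := Real.smoothTransition.le_one ((x - s) / δ)
  have h0 : 0 ≤ (1 - δ) * Real.smoothTransition ((x - s) / δ) + δ * x :=
    add_nonneg (mul_nonneg (by linarith) t0) (mul_nonneg hδ.le hx.1)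
  have h1 : (1 - δ) * Real.smoothTransition ((x - s) / δ) + δ * x ≤ 1 := by
    have := mul_le_of_le_one_right (by linarith : 0 ≤ 1 - δ) t1
    have := mul_le_of_le_one_right hδ.le hx.2
    linarith
  unfold smoothStep
  have := mul_nonneg (by linarith : 0 ≤ 1 - 2 * δ) h0
  have := mul_le_of_le_one_right (by linarith : 0 ≤ 1 - 2 * δ) h1
  constructor <;> linarith

theorem smoothStep_le {s δ x : ℝ} (hδ : 0 < δ) (hx0 : 0 ≤ x) (hx1 : x ≤ 1)
    (hx : x ≤ s) : smoothStep s δ x ≤ 2 * δ := by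
  rw [smoothStep, Real.smoothTransition.zero_of_nonpos
    (div_nonpos_of_nonpos_of_nonneg (by linarith) hδ.le)]
  nlinarith [mul_nonneg hδ.le hx0, mul_le_of_le_one_right hδ.le hx1]

theorem le_smoothStep {s δ x : ℝ} (hδ : 0 < δ) (hδ' : δ < 1 / 2) (hx0 : 0 ≤ x)
    (hx : s + δ ≤ x) : 1 - 2 * δ ≤ smoothStep s δ x := by
  rw [smoothStep, Real.smoothTransition.one_of_one_le ((le_div_iff₀ hδ).2 (by linarith))]
  nlinarith [mul_nonneg hδ.le hx0, mul_nonneg (by linarith : 0 ≤ 1 - 2 * δ) (mul_nonneg hδ.le hx0)]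

/-- A smooth cutoff increasing from `0` at `δ/2` to `1` at `δ`. -/
noncomputable def endCutoff (δ x : ℝ) : ℝ := Real.smoothTransition (x * (2 / δ) - 1)

theorem contDiff_endCutoff (δ : ℝ) : ContDiff ℝ ∞ (endCutoff δ) :=
  Real.smoothTransition.contDiff.comp (by fun_prop)

theorem endCutoff_eq_zero {δ x : ℝ} (hδ : 0 < δ) (hx : x ≤ δ / 2) : endCutoff δ x = 0 := by
  refine Real.smoothTransition.zero_of_nonpos ?_
  rw [← mul_div_assoc, sub_nonpos, div_le_one hδ]
  linarith

theorem endCutoff_eq_one {δ x : ℝ} (hδ : 0 < δ) (hx : δ ≤ x) : endCutoff δ x = 1 := by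
  refine Real.smoothTransition.one_of_one_le ?_
  rw [← mul_div_assoc, le_sub_iff_add_le, le_div_iff₀ hδ]
  linarith

theorem monotone_endCutoff {δ : ℝ} (hδ : 0 < δ) : Monotone (endCutoff δ) := fun x y hxy =>
  Real.smoothTransition.monotone
    (sub_le_sub_right (mul_le_mul_of_nonneg_right hxy (by positivity)) 1)

/-- Blending preserves monotonicity because `σ ≤ δ ≤ h` on `[0, δ]`, where `α` increases, and `h ≤ 1
- δ ≤ τ` on `[1 - δ, 1]`, where `β` decreases. -/
theorem exists_mem_increasingWithEnds_near_step {σ τ : ℝ → ℝ} {δ : ℝ} (hδ : 0 < δ)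
    (hδ' : δ < 1 / 2) (hσ : ContDiff ℝ ∞ σ) (hτ : ContDiff ℝ ∞ τ)
    (hσm : MapsTo σ (Icc 0 δ) (Icc 0 δ)) (hτm : MapsTo τ (Icc (1 - δ) 1) (Icc (1 - δ) 1))
    (hσ' : ∀ x ∈ Ioc 0 δ, 0 < deriv σ x) (hτ' : ∀ x ∈ Ico (1 - δ) 1, 0 < deriv τ x) (s : ℝ) :
    ∃ f ∈ increasingWithEnds σ τ δ, (∀ x ∈ Icc δ (1 - δ), x < s → f x ≤ 2 * δ) ∧
      ∀ x ∈ Icc δ (1 - δ), s + δ ≤ x → 1 - 2 * δ ≤ f x := by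
  set h := smoothStep s δ with hh
  have hhc : ContDiff ℝ ∞ h := contDiff_smoothStep s δ
  set α := endCutoff δ with hα
  set β : ℝ → ℝ := fun x => endCutoff δ (1 - x) with hβ
  have hαc : ContDiff ℝ ∞ α := contDiff_endCutoff δ
  have hβc : ContDiff ℝ ∞ β := (contDiff_endCutoff δ).comp (by fun_prop)
  have hα0 : ∀ x ≤ δ / 2, α x = 0 := fun x => endCutoff_eq_zero hδ
  have hα1 : ∀ x, δ ≤ x → α x = 1 := fun x => endCutoff_eq_one hδ
  have hβ0 : ∀ x, 1 - δ / 2 ≤ x → β x = 0 := fun x hx => endCutoff_eq_zero hδ (by linarith)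
  have hβ1 : ∀ x ≤ 1 - δ, β x = 1 := fun x hx => endCutoff_eq_one hδ (by linarith)
  have hα' : ∀ x, 0 ≤ deriv α x := fun x => (monotone_endCutoff hδ).deriv_nonneg
  have hβ' : ∀ x, deriv β x ≤ 0 := fun x =>
    Antitone.deriv_nonpos fun y z hyz => monotone_endCutoff hδ (by linarith)
  have hmid : ∀ x ∈ Icc δ (1 - δ),
      h x + (1 - α x) * (σ x - h x) + (1 - β x) * (τ x - h x) = h x := fun x hx => by
    rw [hα1 x hx.1, hβ1 x hx.2]; ring
  refine ⟨fun x => h x + (1 - α x) * (σ x - h x) + (1 - β x) * (τ x - h x), ⟨?_, ?_, ?_, ?_⟩,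
    ?_, ?_⟩
  · fun_prop
  · intro x hx
    simp only [hα0 x hx.2, hβ1 x (by linarith [hx.2])]
    ring
  · intro x hx
    simp only [hβ0 x hx.1, hα1 x (by linarith [hx.1])]
    ring
  · intro x hx
    have hxh := smoothStep_mem_Icc (s := s) hδ hδ' (Ioo_subset_Icc_self hx)
    have hh' : 0 < deriv h x := deriv_smoothStep_pos hδ hδ' x
    have hd : ∀ {g : ℝ → ℝ}, ContDiff ℝ ∞ g → Differentiable ℝ g :=
      fun hg => hg.differentiable (by simp)
    rcases lt_or_ge δ x with h1 | h1
    · have e : (fun x => h x + (1 - α x) * (σ x - h x) + (1 - β x) * (τ x - h x)) =ᶠ[𝓝 x]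
          fun y => h y + (1 - β y) * (τ y - h y) := by
        filter_upwards [lt_mem_nhds h1] with y hy
        rw [hα1 y hy.le]; ring
      rw [e.deriv_eq]
      rcases lt_or_ge x (1 - δ) with h2 | h2
      · have e : (fun y => h y + (1 - β y) * (τ y - h y)) =ᶠ[𝓝 x] h := by
          filter_upwards [gt_mem_nhds h2] with y hy
          rw [hβ1 y hy.le]; ring
        rwa [e.deriv_eq]
      · have hτx := hτm ⟨h2, hx.2.le⟩
        exact deriv_blend_pos (hd hτ) (hd hhc) (hd hβc) (Real.smoothTransition.nonneg _)
          (Real.smoothTransition.le_one _) (hτ' x ⟨h2, hx.2⟩) hh'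
          (mul_nonneg_of_nonpos_of_nonpos (hβ' x) (by linarith [hτx.1, hxh.2]))
    · have e : (fun x => h x + (1 - α x) * (σ x - h x) + (1 - β x) * (τ x - h x)) =ᶠ[𝓝 x]
          fun y => h y + (1 - α y) * (σ y - h y) := by
        filter_upwards [gt_mem_nhds (show x < 1 - δ by linarith)] with y hy
        rw [hβ1 y hy.le]; ring
      rw [e.deriv_eq]
      have hσx := hσm ⟨hx.1.le, h1⟩
      exact deriv_blend_pos (hd hσ) (hd hhc) (hd hαc) (Real.smoothTransition.nonneg _)
        (Real.smoothTransition.le_one _) (hσ' x ⟨hx.1, h1⟩) hh'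
        (mul_nonneg (hα' x) (by linarith [hσx.2, hxh.1]))
  · intro x hx hxs
    simp only [hmid x hx]
    exact smoothStep_le hδ (by linarith [hx.1]) (by linarith [hx.2]) hxs.le
  · intro x hx hxs
    simp only [hmid x hx]
    exact le_smoothStep hδ hδ' (by linarith [hx.1]) hxs

/-! ### The attained triples and the conclusion -/

theorem convex_image_iteratedIntegrals {S : Set (ℝ → ℝ)} (hS : Convex ℝ S)
    (hc : ∀ f ∈ S, Continuous f) : Convex ℝ (iteratedIntegrals '' S) := by
  rintro _ ⟨f, hf, rfl⟩ _ ⟨g, hg, rfl⟩ p q hp hq hpq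
  refine ⟨p • f + q • g, hS hf hg hp hq hpq, ?_⟩
  have key : ∀ w : ℝ → ℝ, Continuous w → ∫ x in (0 : ℝ)..1, w x * (p • f + q • g) x =
      p * (∫ x in (0 : ℝ)..1, w x * f x) + q * ∫ x in (0 : ℝ)..1, w x * g x := by
    intro w hw
    have hf := hc f hf
    have hg := hc g hg
    rw [← intervalIntegral.integral_const_mul, ← intervalIntegral.integral_const_mul,
      ← intervalIntegral.integral_add (Continuous.intervalIntegrable (by fun_prop) _ _)
        (Continuous.intervalIntegrable (by fun_prop) _ _)]
    congr 1
    ext x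
    simp only [Pi.add_apply, Pi.smul_apply, smul_eq_mul]
    ring
  simp only [iteratedIntegrals, Prod.smul_mk, Prod.mk_add_mk, smul_eq_mul, Prod.mk.injEq]
  exact ⟨key _ (by fun_prop), key _ (by fun_prop), key _ (by fun_prop)⟩

theorem dist_iteratedIntegrals_momentCurve_le {f : ℝ → ℝ} {u δ : ℝ} (hf : Continuous f)
    (hδ : 0 ≤ δ) (hu : u ∈ Icc (0 : ℝ) 1) (hf01 : MapsTo f (Icc 0 1) (Icc 0 1))
    (hlo : ∀ x ∈ Icc δ (1 - δ), x < 1 - u → f x ≤ 2 * δ)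
    (hhi : ∀ x ∈ Icc δ (1 - δ), 1 - u + δ ≤ x → 1 - 2 * δ ≤ f x) :
    dist (iteratedIntegrals f) (momentCurve u) ≤ 5 * δ := by
  have key : ∀ {w : ℝ → ℝ} {m : ℝ}, Continuous w → (∀ x ∈ Icc (0 : ℝ) 1, |w x| ≤ 1) →
      ∫ x in (1 - u)..1, w x = m → |(∫ x in (0 : ℝ)..1, w x * f x) - m| ≤ 5 * δ := by
    rintro w m hw hw1 rfl
    exact abs_integral_sub_integral_step_le hf hw hδ (by linarith [hu.2]) (by linarith [hu.1])
      hw1 hf01 hlo hhi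
  have hsub : ∀ g : ℝ → ℝ, ∫ x in (1 - u)..1, g (1 - x) = ∫ x in (0 : ℝ)..u, g x := fun g => by
    simp
  simp only [iteratedIntegrals, momentCurve, Prod.dist_eq, Real.dist_eq, max_le_iff]
  refine ⟨key continuous_const (by simp) (by simp), key (by fun_prop) ?_ ?_,
    key (by fun_prop) ?_ ?_⟩
  · intro x hx
    rw [abs_le]; constructor <;> linarith [hx.1, hx.2]
  · rw [hsub fun x => x]; simp
  · intro x hx
    rw [abs_le]; constructor <;> nlinarith [hx.1, hx.2]
  · rw [hsub fun x => x ^ 2 / 2, intervalIntegral.integral_div, integral_pow]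
    norm_num
    ring

theorem theoremt (σ τ : ℝ → ℝ → ℝ) (hσ : IsLeftEndFamily σ) (hτ : IsRightEndFamily τ)
    (a b c : ℝ) (ha0 : 0 < a) (ha1 : a < 1)
    (hb1 : a ^ 2 / 2 < b) (hb2 : b < a / 2)
    (hc1 : 2 * b ^ 2 / (3 * a) < c)
    (hc2 : c < (-a ^ 2 + 2 * a * b - 4 * b ^ 2 + 2 * b) / (6 * (1 - a))) :
    ∃ δ₀ : ℝ, 0 < δ₀ ∧ ∀ δ : ℝ, 0 < δ → δ < δ₀ →
      ∃ f : ℝ → ℝ,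
        ContDiffOn ℝ ∞ f (Icc 0 1) ∧
        MapsTo f (Icc 0 1) (Icc 0 1) ∧
        EqOn f (σ δ) (Icc 0 (δ / 2)) ∧
        EqOn f (τ δ) (Icc (1 - δ / 2) 1) ∧
        (∀ x ∈ Ioo (0 : ℝ) 1, 0 < deriv f x) ∧
        integralOp f 1 = a ∧
        integralOp^[2] f 1 = b ∧
        integralOp^[3] f 1 = c := by
  have hp : (a, b, c) ∈ momentRegion :=
    ⟨ha0, ha1, hb1, hb2, (div_lt_iff₀ (by linarith)).1 hc1, (lt_div_iff₀ (by linarith)).1 hc2⟩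
  obtain ⟨r, hr, hball⟩ := Metric.isOpen_iff.1 isOpen_momentRegion _ hp
  -- `δ < 1/2` separates the two end zones; `δ < r/12` makes the error `5 * δ` less than `r/2`.
  refine ⟨min (1 / 2) (r / 12), by positivity, fun δ hδ hlt => ?_⟩
  obtain ⟨hlt1, hlt2⟩ := lt_min_iff.1 hlt
  have hmaps : ∀ f ∈ increasingWithEnds (σ δ) (τ δ) δ, MapsTo f (Icc 0 1) (Icc 0 1) := fun f hf =>
    mapsTo_of_mem_increasingWithEnds hδ (hσ.map_zero δ hδ) (hτ.map_one δ hδ) hf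
  set S := iteratedIntegrals '' increasingWithEnds (σ δ) (τ δ) δ with hS
  have hSc : Convex ℝ S := convex_image_iteratedIntegrals (convex_increasingWithEnds _ _ _)
    fun f hf => hf.1.continuous
  have hcurve : momentCurve '' Icc 0 1 ⊆ Metric.thickening (r / 2) S := by
    rintro _ ⟨u, hu, rfl⟩
    obtain ⟨f, hf, hlo, hhi⟩ := exists_mem_increasingWithEnds_near_step hδ hlt1
      (hσ.continuous.1 δ hδ) (hτ.continuous.1 δ hδ) (hσ.mapsTo δ hδ) (hτ.mapsTo δ hδ)
      (hσ.deriv_pos δ hδ) (hτ.deriv_pos δ hδ) (1 - u)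
    refine Metric.mem_thickening_iff.2 ⟨_, mem_image_of_mem _ hf, ?_⟩
    rw [dist_comm]
    have := dist_iteratedIntegrals_momentCurve_le hf.1.continuous hδ.le hu (hmaps f hf) hlo hhi
    linarith
  -- A thickening of a convex set is convex, so it contains the hull of the curve once it contains
  -- the curve.
  have hmem : (a, b, c) ∈ S := hSc.mem_of_ball_subset_thickening (half_pos hr) (half_lt_self hr)
    (hball.trans (momentRegion_subset_convexHull.trans
      (convexHull_min hcurve (hSc.thickening _))))
  obtain ⟨f, hf, hfe⟩ := hmem
  rw [iteratedIntegrals_eq hf.1.continuous, Prod.mk.injEq, Prod.mk.injEq] at hfe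
  exact ⟨f, hf.1.contDiffOn, hmaps f hf, hf.2.1, hf.2.2.1, hf.2.2.2, hfe⟩
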